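/- **Irrelevance of income.** Let $\mathsf Z$ be a finite set, $P=(P_{z\hat z})$ a transition probability matrix on $\mathsf Z$, and $\gamma>0$. An income fluctuation problem consists of $\mathsf Z$, $P$, the law of an i.i.d. innovation $\zeta$ with values in a measurable space, and nonnegative measurable functions $\beta(z,\hat z,\zeta)$ (discount factor), $R(z,\hat z,\zeta)$ (gross return on wealth), $Y(z,\hat z,\zeta)$ (income). Utility has constant relative risk aversion $\gamma$, so $u'(c)=c^{-\gamma}$ and $u'(0)=\infty$. Put $K_{z\hat z}(\theta)=P_{z\hat z}\,\mathrm E[\beta(z,\hat z,\zeta)R(z,\hat z,\zeta)^\theta]$, with $0\cdot\infty=0$, and let $r$ denote the spectral radius. Assume that 1. the matrices $K(0)$ and $K(1)$ are finite, and $r(K(0))<1$, $r(K(1))<1$; 2. for all $z,\hat z\in\mathsf Z$ the expectations of $Y(z,\hat z,\zeta)$, of $u'(Y(z,\hat z,\zeta))$ and of $\beta(z,\hat z,\zeta)R(z,\hat z,\zeta)u'(Y(z,\hat z,\zeta))$ are finite. Let $\mathcal C$ be the set of functions $c:(0,\infty)\times\mathsf Z\to\mathbb R$ that are continuous, nondecreasing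 in the first argument, and satisfy $0\le c(a,z)\le a$ and $\sup_{a,z}|u'(c(a,z))-u'(a)|<\infty$. A *consumption function* of the problem is a $c\in\mathcal C$ that is a fixed point of the time iteration operator, i.e. for all $a>0$ and $z\in\mathsf Z$ the number $\xi=c(a,z)\in[0,a]$ solves the Euler equation $$u'(\xi)=\min\Big\{\max\Big\{\sum_{\hat z\in\mathsf Z}P_{z\hat z}\,\mathrm E\big[\beta R\,u'\big(c(R\,(a-\xi)+Y,\hat z)\big)\big],\,u'(a)\Big\},\,u'(0)\Big\},$$ where $\beta,R,Y$ are evaluated at $(z,\hat z,\zeta)$. Then there is exactly one consumption function $c$, the asymptotic marginal propensities to consume $\bar c(z)=\lim_{a\to\infty}c(a,z)/a\in[0,1]$ exist for all $z\in\mathsf Z$, and they depend only on $\gamma$, $P$, $\beta$ and $R$, and not on the income $Y$: if two income fluctuation problems satisfy these assumptions and have the same $\mathsf Z$, $\gamma$, $P$ and, for each $(z,\hat z)$, the same joint distribution of $(\beta(z,\hat z,\zeta),R(z,\hat z,\zeta))$ (in particular if they share the innovation and the functions $\beta$ and $R$), then they have the same asymptotic marginal propensities to consume, whatever their incomes are.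 -/

import Mathlib

open MeasureTheory ProbabilityTheory Filter Topology Set
open scoped NNReal ENNReal

/-- The primitives of an income fluctuation problem, except for preferences: a finite state space
`Z` with a transition probability matrix `P`, the law `μ` of the i.i.d. innovation `ζ` (with values
in an arbitrary measurable space `S`), and nonnegative measurable functions `β`, `R`, `Y` of
(current state, next state, innovation), which give the discount factor, the gross return on wealth
and the non-financial income. -/
structure IncomeFluctuation (Z S : Type*) [Fintype Z] [DecidableEq Z] [MeasurableSpace S] where
  P : Matrix Z Z ℝ
  P_mem : P ∈ Matrix.rowStochastic ℝ Z
  μ : Measure S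
  isProb : IsProbabilityMeasure μ
  β : Z → Z → S → ℝ≥0
  R : Z → Z → S → ℝ≥0
  Y : Z → Z → S → ℝ≥0
  measurable_β : ∀ z z', Measurable (β z z')
  measurable_R : ∀ z z', Measurable (R z z')
  measurable_Y : ∀ z z', Measurable (Y z z')

/-- The utility function with constant relative risk aversion `γ`, at positive consumption. -/
noncomputable def crraUtility (γ c : ℝ) : ℝ :=
  if γ = 1 then Real.log c else c ^ (1 - γ) / (1 - γ)

/-- The marginal utility `u'(c) = c ^ (-γ)` for `c ≥ 0`, with `u'(0) = ∞` when `γ > 0`. -/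
noncomputable def marginalUtility (γ c : ℝ) : ℝ≥0∞ :=
  ENNReal.ofReal c ^ (-γ)

theorem marginalUtility_zero {γ : ℝ} (hγ : 0 < γ) : marginalUtility γ 0 = ⊤ := by
  simp [marginalUtility, hγ]

/-- On `(0, ∞)`, `marginalUtility` is the derivative of `crraUtility`. -/
theorem hasDerivAt_crraUtility (γ : ℝ) {c : ℝ} (hc : 0 < c) :
    HasDerivAt (crraUtility γ) (marginalUtility γ c).toReal c := by
  have h : (marginalUtility γ c).toReal = c ^ (-γ) := by
    rw [marginalUtility, ENNReal.ofReal_rpow_of_pos hc, ENNReal.toReal_ofReal (by positivity)]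
  rw [h]
  by_cases hγ : γ = 1
  · subst hγ
    have : crraUtility 1 = Real.log := by ext x; simp [crraUtility]
    rw [this, Real.rpow_neg_one]
    exact Real.hasDerivAt_log hc.ne'
  · have h1 : (1 - γ) ≠ 0 := sub_ne_zero.2 (Ne.symm hγ)
    have : crraUtility γ = fun x => x ^ (1 - γ) / (1 - γ) := by ext x; simp [crraUtility, hγ]
    rw [this]
    have h2 := (Real.hasDerivAt_rpow_const (x := c) (p := 1 - γ) (Or.inl hc.ne')).div_const (1 - γ)
    rwa [mul_div_cancel_left₀ _ h1, show 1 - γ - 1 = -γ by ring] at h2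

namespace IncomeFluctuation

variable {Z S : Type*} [Fintype Z] [DecidableEq Z] [MeasurableSpace S]

/-- The matrix with entries `K_{z z'}(θ) = P_{z z'} E[β(z, z', ζ) R(z, z', ζ) ^ θ] ∈ [0, ∞]`,
which the assumptions below involve for `θ = 0` and `θ = 1` (with `0 ^ 0 = 1`). -/
noncomputable def K (M : IncomeFluctuation Z S) (θ : ℝ) : Matrix Z Z ℝ≥0∞ :=
  fun z z' => ENNReal.ofReal (M.P z z') * ∫⁻ s, (M.β z z' s : ℝ≥0∞) * (M.R z z' s : ℝ≥0∞) ^ θ ∂M.μ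

/-- The spectral radius (largest absolute value of the complex eigenvalues) of a matrix with
entries in `[0, ∞]`; only used for matrices with finite entries. -/
noncomputable def specRadius (A : Matrix Z Z ℝ≥0∞) : ℝ≥0∞ :=
  spectralRadius ℂ (A.map fun x => (x.toReal : ℂ))

/-- The assumptions on the income fluctuation problem, for constant relative risk aversion `γ`. -/
structure Assumptions (M : IncomeFluctuation Z S) (γ : ℝ) : Prop where
  K_zero_finite : ∀ z z', M.K 0 z z' < ⊤
  K_one_finite : ∀ z z', M.K 1 z z' < ⊤
  specRadius_K_zero : specRadius (M.K 0) < 1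
  specRadius_K_one : specRadius (M.K 1) < 1
  income_finite : ∀ z z', ∫⁻ s, (M.Y z z' s : ℝ≥0∞) ∂M.μ < ⊤
  marginal_finite : ∀ z z', ∫⁻ s, marginalUtility γ (M.Y z z' s) ∂M.μ < ⊤
  discounted_marginal_finite : ∀ z z',
    ∫⁻ s, (M.β z z' s : ℝ≥0∞) * (M.R z z' s : ℝ≥0∞) * marginalUtility γ (M.Y z z' s) ∂M.μ < ⊤

/-- The space `𝒞` of candidate consumption functions `c : (0, ∞) × Z → ℝ`; values `c a z` with
`a ≤ 0` are irrelevant. The last field says that `|u'(c(a, z)) - u'(a)|` is bounded: this difference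
is nonnegative because `c(a, z) ≤ a`. -/
structure IsCandidate (γ : ℝ) (c : ℝ → Z → ℝ) : Prop where
  continuousOn : ∀ z, ContinuousOn (fun a => c a z) (Ioi 0)
  monotoneOn : ∀ z, MonotoneOn (fun a => c a z) (Ioi 0)
  nonneg : ∀ a, 0 < a → ∀ z, 0 ≤ c a z
  le_wealth : ∀ a, 0 < a → ∀ z, c a z ≤ a
  bounded : ∃ B : ℝ≥0, ∀ a, 0 < a → ∀ z,
    marginalUtility γ (c a z) ≤ marginalUtility γ a + B

/-- `E_z[β̂ R̂ u'(c(R̂ (a - ξ) + Ŷ, Ẑ))]`: the expected discounted marginal utility of next-period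
consumption, at current wealth `a`, state `z` and consumption `ξ`. -/
noncomputable def expectedMarginal (M : IncomeFluctuation Z S) (γ : ℝ) (c : ℝ → Z → ℝ)
    (a : ℝ) (z : Z) (ξ : ℝ) : ℝ≥0∞ :=
  ∑ z', ENNReal.ofReal (M.P z z') *
    ∫⁻ s, (M.β z z' s : ℝ≥0∞) * (M.R z z' s : ℝ≥0∞) *
      marginalUtility γ (c ((M.R z z' s : ℝ) * (a - ξ) + (M.Y z z' s : ℝ)) z') ∂M.μ

/-- `ξ ∈ [0, a]` solves the Euler equation at wealth `a` and state `z`, when the consumption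
function of the next period is `c`; that is, `ξ = Tc(a, z)` for the time iteration operator `T`. -/
def SolvesEuler (M : IncomeFluctuation Z S) (γ : ℝ) (c : ℝ → Z → ℝ) (a : ℝ) (z : Z) (ξ : ℝ) :
    Prop :=
  ξ ∈ Icc 0 a ∧
    marginalUtility γ ξ =
      min (max (M.expectedMarginal γ c a z ξ) (marginalUtility γ a)) (marginalUtility γ 0)

/-- `c` is a consumption function of the income fluctuation problem: a fixed point in `𝒞` of the
time iteration operator. -/
def IsConsumptionFunction (M : IncomeFluctuation Z S) (γ : ℝ) (c : ℝ → Z → ℝ) : Prop :=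
  IsCandidate γ c ∧ ∀ a, 0 < a → ∀ z, M.SolvesEuler γ c a z (c a z)

/-- The problem has exactly one consumption function `c` (on `(0, ∞) × Z`), and the limits
`lim_{a → ∞} c(a, z) / a` exist and equal `cbar z`, for all `z`. -/
def HasAsymptoticMPC (M : IncomeFluctuation Z S) (γ : ℝ) (cbar : Z → ℝ) : Prop :=
  ∃ c : ℝ → Z → ℝ, M.IsConsumptionFunction γ c ∧
    (∀ d : ℝ → Z → ℝ, M.IsConsumptionFunction γ d → ∀ a, 0 < a → ∀ z, d a z = c a z) ∧
    ∀ z, Tendsto (fun a => c a z / a) atTop (𝓝 (cbar z))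

end IncomeFluctuation

/-! Because `u'` is a power, `u'(a l) = u'(a) u'(l)`. Dividing the Euler equation by `u'(a)` and
letting wealth grow makes income negligible and leaves an equation for the marginal utilities `x z`
of the consumption shares: `x = (1 + (L x) ^ (1/γ)) ^ γ`, where `L` has entries `P E[β R ^ (1 - γ)]`
and does not involve income. The equation can have several solutions in `[0, ∞]`; the limit of
`u'(c(a, z) / a)` is the least one, `x*`.

Upper bound: income only adds wealth, so time iteration preserves `u'(c) ≤ x u'(a)` for every
solution `x` (`IsTimeIterate.le_mul_share`). A Knaster–Tarski argument among functions with this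
bound for `x*`, and with `u'(c) ≤ u'(a) + B`, yields a consumption function
(`exists_isTimeIterate_self`). The condition `r(K(1)) < 1` provides `B`. It also gives uniqueness,
since the gap between two marginal utilities is dominated by `K(1) ^ n b` for all `n`
(`IsConsumptionFunction.le`).

Lower bound: by Fatou's lemma the lower limits of `u'(c(a, z) / a)` form a pre-fixed point of the
share operator (`IsAdmissible.consumptionMap_liminf_le`), so they are at least `x*`. -/

section MarginalUtility

/-! ### Marginal utility, its inverse, and the optimal share -/

variable {γ : ℝ}

theorem continuous_marginalUtility (γ : ℝ) : Continuous (marginalUtility γ) :=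
  ENNReal.continuous_rpow_const.comp ENNReal.continuous_ofReal

theorem marginalUtility_antitone (hγ : 0 ≤ γ) : Antitone (marginalUtility γ) := by
  intro x y h
  simpa [marginalUtility, ENNReal.rpow_neg] using
    ENNReal.rpow_le_rpow (ENNReal.ofReal_le_ofReal h) hγ

theorem marginalUtility_strictAntiOn (hγ : 0 < γ) : StrictAntiOn (marginalUtility γ) (Ici 0) := by
  intro x hx y _ h
  have := ENNReal.rpow_lt_rpow
    ((ENNReal.ofReal_lt_ofReal_iff (lt_of_le_of_lt hx h)).2 h) hγ
  simpa [marginalUtility, ENNReal.rpow_neg] using this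

theorem marginalUtility_of_nonpos (hγ : 0 < γ) {x : ℝ} (hx : x ≤ 0) :
    marginalUtility γ x = ⊤ := by
  simp [marginalUtility, ENNReal.ofReal_of_nonpos hx, hγ]

theorem marginalUtility_ne_top {x : ℝ} (hx : 0 < x) : marginalUtility γ x ≠ ⊤ := by
  rw [marginalUtility, ENNReal.ofReal_rpow_of_pos hx]
  exact ENNReal.ofReal_ne_top

theorem marginalUtility_ne_zero (hγ : 0 ≤ γ) (x : ℝ) : marginalUtility γ x ≠ 0 := by
  intro h
  rw [marginalUtility, ENNReal.rpow_eq_zero_iff] at h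
  rcases h with ⟨_, h⟩ | ⟨h, _⟩
  · linarith
  · exact ENNReal.ofReal_ne_top h

theorem marginalUtility_mul {x : ℝ} (hx : 0 ≤ x) (y : ℝ) :
    marginalUtility γ (x * y) = marginalUtility γ x * marginalUtility γ y := by
  rw [marginalUtility, ENNReal.ofReal_mul hx,
    ENNReal.mul_rpow_of_ne_top ENNReal.ofReal_ne_top ENNReal.ofReal_ne_top]
  rfl

theorem marginalUtility_one : marginalUtility γ 1 = 1 := by
  simp [marginalUtility]

/-- The inverse of `marginalUtility`. -/
noncomputable def inverseMarginal (γ : ℝ) (y : ℝ≥0∞) : ℝ := (y ^ (-γ⁻¹)).toReal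

theorem inverseMarginal_nonneg (γ : ℝ) (y : ℝ≥0∞) : 0 ≤ inverseMarginal γ y :=
  ENNReal.toReal_nonneg

theorem inverseMarginal_marginalUtility (hγ : 0 < γ) {x : ℝ} (hx : 0 ≤ x) :
    inverseMarginal γ (marginalUtility γ x) = x := by
  rw [inverseMarginal, marginalUtility, ← ENNReal.rpow_mul, neg_mul_neg,
    mul_inv_cancel₀ hγ.ne', ENNReal.rpow_one, ENNReal.toReal_ofReal hx]

theorem marginalUtility_inverseMarginal (hγ : 0 < γ) {y : ℝ≥0∞} (hy : y ≠ 0) :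
    marginalUtility γ (inverseMarginal γ y) = y := by
  rw [inverseMarginal, marginalUtility, ENNReal.ofReal_toReal, ← ENNReal.rpow_mul, neg_mul_neg,
    inv_mul_cancel₀ hγ.ne', ENNReal.rpow_one]
  simp [ENNReal.rpow_eq_top_iff, hy, hγ.le]

theorem inverseMarginal_continuousAt (hγ : 0 < γ) {y : ℝ≥0∞} (hy : y ≠ 0) :
    ContinuousAt (inverseMarginal γ) y := by
  refine (ENNReal.tendsto_toReal ?_).comp ENNReal.continuous_rpow_const.continuousAt
  simp [ENNReal.rpow_eq_top_iff, hy, hγ.le]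

theorem inverseMarginal_le (hγ : 0 < γ) {x : ℝ} (hx : 0 ≤ x) {y : ℝ≥0∞}
    (h : marginalUtility γ x ≤ y) : inverseMarginal γ y ≤ x := by
  have hy : y ≠ 0 := fun h0 => marginalUtility_ne_zero hγ.le x (le_antisymm (h0 ▸ h) bot_le)
  by_contra! hlt
  have := marginalUtility_strictAntiOn hγ hx (inverseMarginal_nonneg γ y) hlt
  rw [marginalUtility_inverseMarginal hγ hy] at this
  exact absurd h this.not_ge

theorem le_of_marginalUtility_le (hγ : 0 < γ) {x y : ℝ} (hx : 0 ≤ x)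
    (h : marginalUtility γ x ≤ marginalUtility γ y) : y ≤ x := by
  by_contra! hlt
  exact (marginalUtility_strictAntiOn hγ hx (hx.trans hlt.le) hlt).not_ge h

/-- The map `G ↦ (1 + G ^ (1 / γ)) ^ γ`: if the marginal value of saving the amount `1 - ξ` out
of the wealth `1` is `G u'(1 - ξ)`, this is the marginal utility of optimal consumption. -/
noncomputable def consumptionMap (γ : ℝ) (G : ℝ≥0∞) : ℝ≥0∞ := (1 + G ^ γ⁻¹) ^ γ

theorem consumptionMap_strictMono (hγ : 0 < γ) : StrictMono (consumptionMap γ) := by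
  intro x y h
  refine ENNReal.rpow_lt_rpow ?_ hγ
  exact ENNReal.add_lt_add_left ENNReal.one_ne_top (ENNReal.rpow_lt_rpow h (inv_pos.2 hγ))

theorem one_le_consumptionMap (hγ : 0 < γ) (G : ℝ≥0∞) : 1 ≤ consumptionMap γ G :=
  ENNReal.one_le_rpow le_self_add hγ

theorem consumptionMap_top (hγ : 0 < γ) : consumptionMap γ ⊤ = ⊤ := by
  simp [consumptionMap, hγ]

/-- Every interior share `l` is optimal for the value of savings `G = ((1 - l) / l) ^ γ`. Since both
sides of the first-order condition are monotone in `G`, the inequalities at `l` below reduce to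
comparisons with this `G`. -/
theorem exists_marginalUtility_eq (hγ : 0 < γ) {l : ℝ} (h0 : 0 < l) (h1 : l < 1) :
    ∃ G : ℝ≥0∞, marginalUtility γ l = marginalUtility γ (1 - l) * G ∧
      marginalUtility γ l = consumptionMap γ G := by
  have h2 : 0 < 1 - l := by linarith
  have h3 : 0 < (1 - l) / l := by positivity
  refine ⟨ENNReal.ofReal ((1 - l) / l) ^ γ, ?_, ?_⟩
  · rw [marginalUtility, marginalUtility, ENNReal.ofReal_rpow_of_pos h0,
      ENNReal.ofReal_rpow_of_pos h2, ENNReal.ofReal_rpow_of_pos h3,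
      ← ENNReal.ofReal_mul (by positivity), Real.div_rpow h2.le h0.le, Real.rpow_neg h0.le,
      Real.rpow_neg h2.le]
    congr 1
    have : (1 - l) ^ γ ≠ 0 := by positivity
    field_simp
  · rw [consumptionMap, ← ENNReal.rpow_mul, mul_inv_cancel₀ hγ.ne', ENNReal.rpow_one,
      ← ENNReal.ofReal_one, ← ENNReal.ofReal_add zero_le_one h3.le, marginalUtility,
      ENNReal.rpow_neg, ← ENNReal.inv_rpow, ← ENNReal.ofReal_inv_of_pos h0]
    congr 2
    field_simp
    ring

theorem marginalUtility_le_mul_iff (hγ : 0 < γ) {l : ℝ} (h0 : 0 < l) (h1 : l < 1) (G : ℝ≥0∞) :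
    marginalUtility γ l ≤ marginalUtility γ (1 - l) * G ↔
      marginalUtility γ l ≤ consumptionMap γ G := by
  obtain ⟨G', h, h'⟩ := exists_marginalUtility_eq hγ h0 h1
  have e : marginalUtility γ l ≤ consumptionMap γ G ↔ G' ≤ G := by
    rw [h']
    exact (consumptionMap_strictMono hγ).le_iff_le
  rw [e, h,
    ENNReal.mul_le_mul_iff_right (marginalUtility_ne_zero hγ.le _)
      (marginalUtility_ne_top (by linarith))]

theorem marginalUtility_lt_mul_iff (hγ : 0 < γ) {l : ℝ} (h0 : 0 < l) (h1 : l < 1) (G : ℝ≥0∞) :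
    marginalUtility γ l < marginalUtility γ (1 - l) * G ↔
      marginalUtility γ l < consumptionMap γ G := by
  obtain ⟨G', h, h'⟩ := exists_marginalUtility_eq hγ h0 h1
  have e : marginalUtility γ l < consumptionMap γ G ↔ G' < G := by
    rw [h']
    exact (consumptionMap_strictMono hγ).lt_iff_lt
  rw [e, h,
    ENNReal.mul_lt_mul_iff_right (marginalUtility_ne_zero hγ.le _)
      (marginalUtility_ne_top (by linarith))]

end MarginalUtility

/-- Fatou's lemma for the counting measure. -/
theorem ENNReal.sum_liminf_le_liminf_sum {ι α : Type*} [Fintype ι] (l : Filter α)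
    [l.IsCountablyGenerated] (f : α → ι → ℝ≥0∞) :
    ∑ i, liminf (fun a => f a i) l ≤ liminf (fun a => ∑ i, f a i) l := by
  let _ : MeasurableSpace ι := ⊤
  have := lintegral_liminf_le (μ := Measure.count) (u := l) (f := f)
    (fun a => measurable_from_top)
  simpa [lintegral_fintype] using this

/-! ### Nonnegative matrices with spectral radius less than one -/

section SpectralRadius

attribute [local instance] Matrix.linftyOpNormedRing Matrix.linftyOpNormedAlgebra

/-- The powers of a complex matrix with spectral radius less than one are summable in norm. -/
theorem Matrix.summable_nnnorm_pow_of_spectralRadius_lt_one {n : Type*} [Fintype n]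
    [DecidableEq n] (A : Matrix n n ℂ) (h : spectralRadius ℂ A < 1) :
    Summable fun k : ℕ => ‖A ^ k‖₊ := by
  -- Gelfand's formula bounds the powers eventually by `q ^ k`.
  obtain ⟨q, hq, hq1⟩ := exists_between h
  lift q to ℝ≥0 using (hq1.trans ENNReal.one_lt_top).ne
  have hev := (spectrum.pow_nnnorm_pow_one_div_tendsto_nhds_spectralRadius A).eventually_lt_const hq
  have hle : ∀ᶠ k : ℕ in atTop, ‖‖A ^ k‖‖ ≤ (q : ℝ) ^ k := by
    filter_upwards [hev, eventually_gt_atTop 0] with k hk hk0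
    have hk' : (0 : ℝ) < k := by exact_mod_cast hk0
    have := ENNReal.rpow_le_rpow hk.le hk'.le
    rw [← ENNReal.rpow_mul, one_div_mul_cancel hk'.ne', ENNReal.rpow_one,
      ENNReal.rpow_natCast] at this
    rw [norm_norm]
    exact_mod_cast this
  have hs : Summable fun k : ℕ => ‖A ^ k‖ :=
    Summable.of_norm_bounded_eventually_nat
      (summable_geometric_of_lt_one q.coe_nonneg (by exact_mod_cast hq1)) hle
  exact NNReal.summable_coe.1 (by simpa using hs)

/-- A matrix with finite nonnegative entries and spectral radius less than one has a finite
positive vector which it strictly contracts. -/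
theorem IncomeFluctuation.exists_supersolution {Z : Type*} [Fintype Z] [DecidableEq Z]
    (A : Matrix Z Z ℝ≥0∞) (hA : ∀ z z', A z z' < ⊤)
    (h : IncomeFluctuation.specRadius A < 1) :
    ∃ X : Z → ℝ≥0∞, (∀ z, X z ≠ ⊤) ∧ ∀ z, 1 + ∑ z', A z z' * X z' = X z := by
  set φ : ℝ≥0 →+* ℂ := Complex.ofRealHom.comp NNReal.toRealHom
  let N : Matrix Z Z ℝ≥0 := A.map ENNReal.toNNReal
  have hAN : ∀ z z', A z z' = (N z z' : ℝ≥0∞) := fun z z' =>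
    (ENNReal.coe_toNNReal (hA z z').ne).symm
  have hφ : ∀ x : ℝ≥0, ‖φ x‖₊ = x := fun x => by
    ext; simp [φ]
  have hNC : A.map (fun x => (x.toReal : ℂ)) = N.map φ := by
    ext z z'; rfl
  rw [IncomeFluctuation.specRadius, hNC] at h
  have hs := Matrix.summable_nnnorm_pow_of_spectralRadius_lt_one _ h
  have hrow : ∀ (k : ℕ) z, ∑ z', (N ^ k) z z' ≤ ‖(N.map φ) ^ k‖₊ := by
    intro k z
    rw [← Matrix.map_pow, Matrix.linfty_opNNNorm_def]
    refine le_trans (le_of_eq ?_)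
      (Finset.le_sup (f := fun i => ∑ j, ‖((N ^ k).map φ) i j‖₊) (Finset.mem_univ z))
    simp [hφ]
  have hsum : ∀ z, Summable fun k : ℕ => ∑ z', (N ^ k) z z' := fun z =>
    NNReal.summable_of_le (fun k => hrow k z) hs
  -- The witness is the Neumann series `∑ A ^ k 1`; splitting off `k = 0` gives the equation.
  refine ⟨fun z => ∑' k : ℕ, ((∑ z', (N ^ k) z z' : ℝ≥0) : ℝ≥0∞),
    fun z => ENNReal.tsum_coe_ne_top_iff_summable.2 (hsum z), fun z => ?_⟩
  beta_reduce
  rw [tsum_eq_zero_add' (f := fun k : ℕ => ((∑ z', (N ^ k) z z' : ℝ≥0) : ℝ≥0∞))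
    ENNReal.summable]
  congr 1
  · simp [Matrix.one_apply]
  · simp_rw [← ENNReal.tsum_mul_left]
    rw [← Summable.tsum_finsetSum (fun _ _ => ENNReal.summable)]
    refine tsum_congr fun k => ?_
    simp_rw [hAN, pow_succ', Matrix.mul_apply]
    rw [Finset.sum_comm]
    push_cast
    simp_rw [Finset.mul_sum]

end SpectralRadius

/-! ### Expected discounted marginal utility and its bounds -/

namespace IncomeFluctuation

variable {Z S : Type*} [Fintype Z] [DecidableEq Z] [MeasurableSpace S]

/-- The expectation `E_z[β̂ R̂ f(Ẑ, ζ)]`. -/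
noncomputable def discountedMean (M : IncomeFluctuation Z S) (z : Z) (f : Z → S → ℝ≥0∞) : ℝ≥0∞ :=
  ∑ z', ENNReal.ofReal (M.P z z') *
    ∫⁻ s, (M.β z z' s : ℝ≥0∞) * (M.R z z' s : ℝ≥0∞) * f z' s ∂M.μ

/-- The expected discounted marginal utility of next-period consumption, as a function of the
savings `s`. -/
noncomputable def savingMarginal (M : IncomeFluctuation Z S) (γ : ℝ) (c : ℝ → Z → ℝ)
    (s : ℝ) (z : Z) : ℝ≥0∞ :=
  M.discountedMean z fun z' t =>
    marginalUtility γ (c ((M.R z z' t : ℝ) * s + (M.Y z z' t : ℝ)) z')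

/-- The matrix with entries `P_{z z'} E[β R ^ (1 - γ)]`, where `R ^ (1 - γ) = 0` if `R = 0`. -/
noncomputable def returnMatrix (M : IncomeFluctuation Z S) (γ : ℝ) (z z' : Z) : ℝ≥0∞ :=
  ENNReal.ofReal (M.P z z') *
    ∫⁻ s, (M.β z z' s : ℝ≥0∞) * (M.R z z' s : ℝ≥0∞) * marginalUtility γ (M.R z z' s) ∂M.μ

variable {M : IncomeFluctuation Z S} {γ : ℝ} {c c' d d' : ℝ → Z → ℝ}

theorem measurable_discount (M : IncomeFluctuation Z S) (z z' : Z) :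
    Measurable fun s => (M.β z z' s : ℝ≥0∞) * (M.R z z' s : ℝ≥0∞) :=
  (M.measurable_β z z').coe_nnreal_ennreal.mul (M.measurable_R z z').coe_nnreal_ennreal

theorem expectedMarginal_eq (a : ℝ) (z : Z) (ξ : ℝ) :
    M.expectedMarginal γ c a z ξ = M.savingMarginal γ c (a - ξ) z := rfl

theorem discountedMean_mono {z : Z} {f f' : Z → S → ℝ≥0∞}
    (h : ∀ z', ∀ᵐ s ∂M.μ, f z' s ≤ f' z' s) : M.discountedMean z f ≤ M.discountedMean z f' := by
  refine Finset.sum_le_sum fun z' _ => mul_le_mul_right (lintegral_mono_ae ?_) _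
  filter_upwards [h z'] with s hs
  gcongr

/-- The weight `β R` vanishes where `R = 0`. This matters for the limit of large wealth, because
next-period wealth grows with savings only where `R > 0`. -/
theorem discountedMean_mono_of_return_pos {z : Z} {f f' : Z → S → ℝ≥0∞}
    (h : ∀ z' s, 0 < M.R z z' s → f z' s ≤ f' z' s) :
    M.discountedMean z f ≤ M.discountedMean z f' := by
  refine Finset.sum_le_sum fun z' _ => mul_le_mul_right (lintegral_mono fun s => ?_) _
  rcases (M.R z z' s).2.eq_or_lt with h0 | h0
  · have : M.R z z' s = 0 := Subtype.ext h0.symm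
    simp [this]
  · exact mul_le_mul_right (h z' s h0) _

theorem discountedMean_const_mul (z : Z) {t : ℝ≥0∞} (ht : t ≠ ⊤) (f : Z → S → ℝ≥0∞) :
    M.discountedMean z (fun z' s => t * f z' s) = t * M.discountedMean z f := by
  simp_rw [discountedMean, Finset.mul_sum]
  refine Finset.sum_congr rfl fun z' _ => ?_
  rw [mul_left_comm t, ← lintegral_const_mul' _ _ ht]
  simp_rw [mul_left_comm t]

/-- Fatou's lemma for `discountedMean`. -/
theorem discountedMean_liminf_le {ι : Type*} {l : Filter ι} [l.NeBot] [l.IsCountablyGenerated]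
    (z : Z) {f : ι → Z → S → ℝ≥0∞} (hf : ∀ i z', Measurable (f i z')) :
    M.discountedMean z (fun z' s => liminf (fun i => f i z' s) l) ≤
      liminf (fun i => M.discountedMean z (f i)) l := by
  have hmul : ∀ (t : ℝ≥0∞) (u : ι → ℝ≥0∞), t * liminf u l ≤ liminf (fun i => t * u i) l :=
    fun t u => by
      have h := ENNReal.le_liminf_mul (u := fun _ => t) (v := u) (f := l)
      rwa [liminf_const] at h
  refine le_trans (Finset.sum_le_sum fun z' _ => ?_)
    (ENNReal.sum_liminf_le_liminf_sum l _)
  refine le_trans (mul_le_mul_right ?_ _) (hmul _ _)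
  exact (lintegral_mono fun s => hmul _ _).trans
    (lintegral_liminf_le fun i => (M.measurable_discount z z').mul (hf i z'))

theorem discountedMean_add_const (z : Z) (f : Z → S → ℝ≥0∞) (x : Z → ℝ≥0∞) :
    M.discountedMean z (fun z' s => f z' s + x z') =
      M.discountedMean z f + ∑ z', M.K 1 z z' * x z' := by
  simp_rw [discountedMean, K, ENNReal.rpow_one, mul_add, ← Finset.sum_add_distrib]
  refine Finset.sum_congr rfl fun z' _ => ?_
  rw [lintegral_add_right _ ((M.measurable_discount z z').mul_const _),
    lintegral_mul_const _ (M.measurable_discount z z'), mul_add, mul_assoc]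

theorem discountedMean_returns (z : Z) (t : ℝ≥0∞) (x : Z → ℝ≥0∞) :
    M.discountedMean z (fun z' s => marginalUtility γ (M.R z z' s) * (x z' * t)) =
      t * ∑ z', M.returnMatrix γ z z' * x z' := by
  simp_rw [discountedMean, returnMatrix, Finset.mul_sum, ← mul_assoc]
  refine Finset.sum_congr rfl fun z' _ => ?_
  have hm : Measurable fun s => (M.β z z' s : ℝ≥0∞) * (M.R z z' s : ℝ≥0∞) *
      marginalUtility γ (M.R z z' s) :=
    (M.measurable_discount z z').mul
      ((continuous_marginalUtility γ).measurable.comp (M.measurable_R z z').coe_nnreal_real)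
  rw [lintegral_mul_const _ (hm.mul_const _), lintegral_mul_const _ hm]
  ring

/-- Since `u'(0) = ∞`, a finite `E[u'(Y)]` excludes zero income. Next-period wealth is then almost
surely in `(0, ∞)`, where candidates are controlled. -/
theorem Assumptions.ae_income_pos (hM : M.Assumptions γ) (hγ : 0 < γ) (z z' : Z) :
    ∀ᵐ s ∂M.μ, 0 < (M.Y z z' s : ℝ) := by
  have hm : Measurable fun s => marginalUtility γ (M.Y z z' s) :=
    (continuous_marginalUtility γ).measurable.comp (M.measurable_Y z z').coe_nnreal_real
  filter_upwards [ae_lt_top hm (hM.marginal_finite z z').ne] with s hs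
  by_contra! h
  exact hs.ne (marginalUtility_of_nonpos hγ h)

/-- This makes the bound `u'(c) ≤ u'(a) + B` reproduce itself under time iteration: next-period
wealth is at least `Y`, so the value of savings is at most `E[β R u'(Y)] + K(1) B`. A multiple of
the Neumann vector of `K(1)` serves as `B`. -/
theorem Assumptions.exists_bound (hM : M.Assumptions γ) :
    ∃ B : Z → ℝ≥0∞, (∀ z, B z ≠ ⊤) ∧
      ∀ z, M.discountedMean z (fun z' s => marginalUtility γ (M.Y z z' s)) +
        ∑ z', M.K 1 z z' * B z' ≤ B z := by
  obtain ⟨X, hX, hX'⟩ := exists_supersolution (M.K 1) hM.K_one_finite hM.specRadius_K_one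
  let b : ℝ≥0∞ := ∑ z, M.discountedMean z (fun z' s => marginalUtility γ (M.Y z z' s))
  have hb : b ≠ ⊤ := ENNReal.sum_ne_top.2 fun z _ => ENNReal.sum_ne_top.2 fun z' _ =>
    ENNReal.mul_ne_top ENNReal.ofReal_ne_top (hM.discounted_marginal_finite z z').ne
  refine ⟨fun z => b * X z, fun z => ENNReal.mul_ne_top hb (hX z), fun z => ?_⟩
  calc _ ≤ b + ∑ z', M.K 1 z z' * (b * X z') := by
        gcongr
        exact Finset.single_le_sum
          (f := fun z => M.discountedMean z (fun z' s => marginalUtility γ (M.Y z z' s)))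
          (fun _ _ => bot_le) (Finset.mem_univ z)
    _ = b * (1 + ∑ z', M.K 1 z z' * X z') := by
        rw [mul_add, mul_one, Finset.mul_sum]
        congr 1
        exact Finset.sum_congr rfl fun z' _ => by ring
    _ = b * X z := by rw [hX' z]

/-- Consumption functions, extended by zero to `(-∞, 0]`, which together with the implied savings
are nondecreasing, and which satisfy two lower bounds, stated as upper bounds on marginal
utility. -/
structure IsAdmissible (γ : ℝ) (B x : Z → ℝ≥0∞) (c : ℝ → Z → ℝ) : Prop where
  monotone : ∀ z, Monotone fun a => c a z
  le_add : ∀ z a a', a ≤ a' → c a' z ≤ c a z + (a' - a)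
  nonneg : ∀ a z, 0 ≤ c a z
  le_max : ∀ a z, c a z ≤ max a 0
  le_add_bound : ∀ a z, marginalUtility γ (c a z) ≤ marginalUtility γ a + B z
  le_mul_share : ∀ a z, marginalUtility γ (c a z) ≤ x z * marginalUtility γ a

/-- `d` is the image of `c` under the time iteration operator, on the whole real line. -/
def IsTimeIterate (M : IncomeFluctuation Z S) (γ : ℝ) (c d : ℝ → Z → ℝ) : Prop :=
  ∀ a z, (0 ≤ d a z ∧ d a z ≤ max a 0) ∧ marginalUtility γ (d a z) =
    max (M.savingMarginal γ c (a - d a z) z) (marginalUtility γ a)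

/-! ### Time iteration on admissible functions -/

variable {B x : Z → ℝ≥0∞}

omit [Fintype Z] [DecidableEq Z] in
theorem IsAdmissible.continuous (hc : IsAdmissible γ B x c) (z : Z) :
    Continuous fun a => c a z := by
  have : LipschitzWith 1 fun a => c a z := by
    refine LipschitzWith.of_le_add fun a b => ?_
    rcases le_total a b with h | h
    · exact (hc.monotone z h).trans (le_add_of_nonneg_right dist_nonneg)
    · rw [Real.dist_eq, abs_of_nonneg (sub_nonneg.2 h)]
      exact hc.le_add z b a h
  exact this.continuous

theorem savingMarginal_antitone (hγ : 0 ≤ γ) (hc : ∀ z, Monotone fun a => c a z) (z : Z) :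
    Antitone fun s => M.savingMarginal γ c s z := fun s s' h =>
  discountedMean_mono fun z' => ae_of_all _ fun t =>
    marginalUtility_antitone hγ (hc z' (by gcongr))

theorem savingMarginal_mono (hγ : 0 ≤ γ) (h : ∀ a z, c a z ≤ c' a z) (s : ℝ) (z : Z) :
    M.savingMarginal γ c' s z ≤ M.savingMarginal γ c s z :=
  discountedMean_mono fun z' => ae_of_all _ fun _ => marginalUtility_antitone hγ (h _ z')

theorem IsAdmissible.marginalUtility_le (hγ : 0 ≤ γ) (hc : IsAdmissible γ B x c) {s : ℝ}
    (hs : 0 ≤ s) (z z' : Z) (t : S) :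
    marginalUtility γ (c (M.R z z' t * s + M.Y z z' t) z') ≤
      marginalUtility γ (M.Y z z' t) + B z' :=
  (hc.le_add_bound _ z').trans <| add_le_add_left
    (marginalUtility_antitone hγ (le_add_of_nonneg_left (by positivity))) _

theorem IsAdmissible.savingMarginal_le (hγ : 0 ≤ γ) (hc : IsAdmissible γ B x c)
    (hB : ∀ z, M.discountedMean z (fun z' s => marginalUtility γ (M.Y z z' s)) +
        ∑ z', M.K 1 z z' * B z' ≤ B z) {s : ℝ} (hs : 0 ≤ s) (z : Z) :
    M.savingMarginal γ c s z ≤ B z := by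
  refine le_trans ?_ (hB z)
  rw [← discountedMean_add_const]
  exact discountedMean_mono fun z' => ae_of_all _ fun t => hc.marginalUtility_le hγ hs z z' t

/-- Dropping income lowers wealth to `R s` and so raises marginal utility; `u'(R s) = u'(R) u'(s)`
then separates the returns from the savings. -/
theorem IsAdmissible.savingMarginal_le_mul (hγ : 0 ≤ γ) (hc : IsAdmissible γ B x c) (s : ℝ)
    (z : Z) :
    M.savingMarginal γ c s z ≤ marginalUtility γ s * ∑ z', M.returnMatrix γ z z' * x z' := by
  rw [← discountedMean_returns]
  refine discountedMean_mono fun z' => ae_of_all _ fun t => (hc.le_mul_share _ z').trans ?_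
  rw [mul_left_comm, ← marginalUtility_mul (by positivity)]
  gcongr
  exact marginalUtility_antitone hγ (le_add_of_nonneg_right (by positivity))

theorem IsAdmissible.continuousOn_savingMarginal (hγ : 0 ≤ γ) (hM : M.Assumptions γ)
    (hc : IsAdmissible γ B x c) (hBtop : ∀ z, B z ≠ ⊤) (z : Z) :
    ContinuousOn (fun s => M.savingMarginal γ c s z) (Ici 0) := by
  intro s₀ hs₀
  refine tendsto_finsetSum _ fun z' _ => ?_
  -- For an impossible transition `0 * ∞ = 0`, so finiteness of `K(1)` does not make `E[β R]` finite
  -- and there is no dominating function.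
  rcases eq_or_ne (ENNReal.ofReal (M.P z z')) 0 with h0 | h0
  · simp only [h0, zero_mul]
    exact tendsto_const_nhds
  refine ENNReal.Tendsto.const_mul ?_ (Or.inr ENNReal.ofReal_ne_top)
  have hcm := ((continuous_marginalUtility γ).comp (hc.continuous z'))
  have hdisc := M.measurable_discount z z'
  refine tendsto_lintegral_filter_of_dominated_convergence
    (fun t => (M.β z z' t : ℝ≥0∞) * (M.R z z' t : ℝ≥0∞) *
      (marginalUtility γ (M.Y z z' t) + B z')) ?_ ?_ ?_ ?_
  · refine Eventually.of_forall fun s => hdisc.mul (hcm.measurable.comp ?_)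
    exact ((M.measurable_R z z').coe_nnreal_real.mul_const _).add
      (M.measurable_Y z z').coe_nnreal_real
  · filter_upwards [self_mem_nhdsWithin] with s hs
    exact ae_of_all _ fun t => mul_le_mul_right (hc.marginalUtility_le hγ hs z z' t) _
  · simp_rw [mul_add]
    rw [lintegral_add_right _ (hdisc.mul_const _), lintegral_mul_const _ hdisc]
    refine ENNReal.add_ne_top.2 ⟨(hM.discounted_marginal_finite z z').ne,
      ENNReal.mul_ne_top ?_ (hBtop z')⟩
    have := hM.K_one_finite z z'
    simp_rw [K, ENNReal.rpow_one] at this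
    exact fun h => this.ne (by rw [h, ENNReal.mul_top h0])
  · refine ae_of_all _ fun t => ENNReal.Tendsto.const_mul ?_
      (Or.inr (ENNReal.mul_ne_top ENNReal.coe_ne_top ENNReal.coe_ne_top))
    exact (hcm.comp (by fun_prop : Continuous fun s : ℝ =>
      (M.R z z' t : ℝ) * s + M.Y z z' t)).continuousWithinAt

/-- Applying the inverse of `u'` to the Euler equation gives a continuous self-map of `[0, a]`,
which has a fixed point. -/
theorem IsAdmissible.exists_timeIterate (hγ : 0 < γ) (hM : M.Assumptions γ)
    (hc : IsAdmissible γ B x c) (hBtop : ∀ z, B z ≠ ⊤) :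
    ∃ d, M.IsTimeIterate γ c d := by
  have key : ∀ a z, ∃ ξ : ℝ, (0 ≤ ξ ∧ ξ ≤ max a 0) ∧ marginalUtility γ ξ =
      max (M.savingMarginal γ c (a - ξ) z) (marginalUtility γ a) := by
    intro a z
    rcases le_or_gt a 0 with ha | ha
    · refine ⟨0, ⟨le_rfl, le_max_right _ _⟩, ?_⟩
      rw [marginalUtility_of_nonpos hγ ha, marginalUtility_zero hγ, max_eq_right le_top]
    have hpos : ∀ ξ, max (M.savingMarginal γ c (a - ξ) z) (marginalUtility γ a) ≠ 0 := fun ξ h =>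
      marginalUtility_ne_zero hγ.le a (le_antisymm ((le_max_right _ _).trans h.le) bot_le)
    have hcont : ContinuousOn (fun ξ => inverseMarginal γ
        (max (M.savingMarginal γ c (a - ξ) z) (marginalUtility γ a))) (Icc 0 a) := by
      intro ξ hξ
      refine ContinuousAt.comp_continuousWithinAt (g := inverseMarginal γ)
        (f := fun ξ => max (M.savingMarginal γ c (a - ξ) z) (marginalUtility γ a))
        (inverseMarginal_continuousAt hγ (hpos ξ)) ?_
      refine Filter.Tendsto.max ?_ tendsto_const_nhds
      exact (hc.continuousOn_savingMarginal hγ.le hM hBtop z (a - ξ) (sub_nonneg.2 hξ.2)).comp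
        (by fun_prop : Continuous fun ξ : ℝ => a - ξ).continuousWithinAt
        fun η hη => sub_nonneg.2 hη.2
    have hmaps : MapsTo (fun ξ => inverseMarginal γ
        (max (M.savingMarginal γ c (a - ξ) z) (marginalUtility γ a))) (Icc 0 a) (Icc 0 a) :=
      fun ξ _ => ⟨inverseMarginal_nonneg _ _, inverseMarginal_le hγ ha.le (le_max_right _ _)⟩
    obtain ⟨ξ, hξ, hfix⟩ := exists_mem_Icc_isFixedPt_of_mapsTo hcont ha.le hmaps
    refine ⟨ξ, ⟨hξ.1, hξ.2.trans (le_max_left _ _)⟩, ?_⟩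
    nth_rewrite 1 [← hfix.eq]
    exact marginalUtility_inverseMarginal hγ (hpos ξ)
  choose d hd using key
  exact ⟨d, hd⟩

/-- In the Euler equation the left side strictly decreases in `ξ` and the right side is
nondecreasing. Raising `c` lowers the right side, so the crossing moves up. -/
theorem IsTimeIterate.mono (hγ : 0 < γ) (hd : M.IsTimeIterate γ c d)
    (hd' : M.IsTimeIterate γ c' d') (hc' : ∀ z, Monotone fun a => c' a z)
    (h : ∀ a z, c a z ≤ c' a z) (a : ℝ) (z : Z) : d a z ≤ d' a z := by
  by_contra! hlt
  refine (marginalUtility_strictAntiOn hγ (hd' a z).1.1 (hd a z).1.1 hlt).not_ge ?_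
  rw [(hd a z).2, (hd' a z).2]
  exact max_le_max ((savingMarginal_antitone hγ.le hc' z (by linarith)).trans
    (savingMarginal_mono hγ.le h _ z)) le_rfl

theorem IsTimeIterate.monotone (hγ : 0 < γ) (hd : M.IsTimeIterate γ c d)
    (hc : ∀ z, Monotone fun a => c a z) (z : Z) : Monotone fun a => d a z := by
  intro a a' h
  by_contra! hlt
  refine (marginalUtility_strictAntiOn hγ (hd a' z).1.1 (hd a z).1.1 hlt).not_ge ?_
  rw [(hd a z).2, (hd a' z).2]
  refine max_le_max (savingMarginal_antitone hγ.le hc z ?_) (marginalUtility_antitone hγ.le h)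
  linarith

theorem IsTimeIterate.le_add (hγ : 0 < γ) (hd : M.IsTimeIterate γ c d)
    (hc : ∀ z, Monotone fun a => c a z) (z : Z) {a a' : ℝ} (h : a ≤ a') :
    d a' z ≤ d a z + (a' - a) := by
  by_contra! hlt
  obtain ⟨⟨h0, h1⟩, h2⟩ := hd a z
  obtain ⟨⟨h0', h1'⟩, h2'⟩ := hd a' z
  rcases le_or_gt a' 0 with ha' | ha'
  · rw [max_eq_right ha'] at h1'
    linarith
  rw [max_eq_left ha'.le] at h1'
  have hlt' := marginalUtility_strictAntiOn hγ h0 h0' (show d a z < d a' z by linarith)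
  have hle : M.savingMarginal γ c (a - d a z) z ≤ marginalUtility γ (d a' z) :=
    (savingMarginal_antitone hγ.le hc z (show a' - d a' z ≤ a - d a z by linarith)).trans
      ((le_max_left _ _).trans h2'.ge)
  rw [h2] at hlt'
  -- Savings would fall from `a` to `a'`, so the value of savings cannot be the larger term at `a`.
  -- Hence all of `a` is consumed, and consumption at `a'` would exceed `a'`.
  rcases lt_max_iff.1 hlt' with h3 | h3
  · exact h3.not_ge hle
  · have : marginalUtility γ (d a z) ≤ marginalUtility γ a := by
      rw [h2]
      exact max_le (hle.trans h3.le) le_rfl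
    have := le_of_marginalUtility_le hγ h0 this
    linarith

/-- After division by `u'(a)`, the share `l` satisfies `u'(l) ≤ max (u'(1 - l) G) 1`. For interior
`l` the first alternative means `u'(l) ≤ consumptionMap γ G`, which is `x z` by the fixed point
equation. -/
theorem IsTimeIterate.le_mul_share (hγ : 0 < γ) (hd : M.IsTimeIterate γ c d)
    (hc : IsAdmissible γ B x c)
    (hx : ∀ z, x z = consumptionMap γ (∑ z', M.returnMatrix γ z z' * x z')) (a : ℝ) (z : Z) :
    marginalUtility γ (d a z) ≤ x z * marginalUtility γ a := by
  have hx1 : 1 ≤ x z := (one_le_consumptionMap hγ _).trans (hx z).ge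
  rcases le_or_gt a 0 with ha | ha
  · rw [marginalUtility_of_nonpos hγ ha, ENNReal.mul_top (by positivity)]
    exact le_top
  obtain ⟨⟨h0, h1⟩, h2⟩ := hd a z
  rw [max_eq_left ha.le] at h1
  set G := ∑ z', M.returnMatrix γ z z' * x z' with hG
  obtain ⟨l, hl⟩ : ∃ l, d a z = a * l := ⟨d a z / a, by field_simp⟩
  have hl0 : 0 ≤ l := by
    rw [hl] at h0
    exact nonneg_of_mul_nonneg_right h0 ha
  have hl1 : l ≤ 1 := by
    rw [hl] at h1
    exact le_of_mul_le_mul_left (h1.trans (mul_one a).ge) ha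
  have hmax : marginalUtility γ (d a z) ≤
      max (marginalUtility γ (a - d a z) * G) (marginalUtility γ a) := by
    rw [h2]
    exact max_le_max (hc.savingMarginal_le_mul hγ.le _ z) le_rfl
  rw [hl, show a - a * l = a * (1 - l) by ring, marginalUtility_mul ha.le,
    marginalUtility_mul ha.le, mul_assoc] at hmax
  rw [hl, marginalUtility_mul ha.le, mul_comm (x z)]
  refine mul_le_mul_right ?_ _
  have hc0 := marginalUtility_ne_zero hγ.le a
  have hct := marginalUtility_ne_top (γ := γ) ha
  replace hmax : marginalUtility γ l ≤ max (marginalUtility γ (1 - l) * G) 1 := by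
    rcases le_max_iff.1 hmax with h | h
    · exact ((ENNReal.mul_le_mul_iff_right hc0 hct).1 h).trans (le_max_left _ _)
    · nth_rewrite 2 [← mul_one (marginalUtility γ a)] at h
      exact ((ENNReal.mul_le_mul_iff_right hc0 hct).1 h).trans (le_max_right _ _)
  rcases le_max_iff.1 hmax with h | h
  swap
  · exact h.trans hx1
  -- Consuming nothing forces `G = ∞`, hence `x z = ∞`.
  rcases hl0.eq_or_lt with rfl | hl0
  · rw [marginalUtility_zero hγ, sub_zero, marginalUtility_one, one_mul, top_le_iff] at h
    rw [hx z, ← hG, h, consumptionMap_top hγ]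
    exact le_top
  rcases hl1.eq_or_lt with rfl | hl1
  · rwa [marginalUtility_one]
  rw [hx z]
  exact (marginalUtility_le_mul_iff hγ hl0 hl1 G).1 h

theorem IsTimeIterate.isAdmissible (hγ : 0 < γ) (hd : M.IsTimeIterate γ c d)
    (hc : IsAdmissible γ B x c)
    (hB : ∀ z, M.discountedMean z (fun z' s => marginalUtility γ (M.Y z z' s)) +
        ∑ z', M.K 1 z z' * B z' ≤ B z)
    (hx : ∀ z, x z = consumptionMap γ (∑ z', M.returnMatrix γ z z' * x z')) :
    IsAdmissible γ B x d where
  monotone := hd.monotone hγ hc.monotone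
  le_add z _ _ h := hd.le_add hγ hc.monotone z h
  nonneg a z := (hd a z).1.1
  le_max a z := (hd a z).1.2
  le_add_bound a z := by
    rcases le_or_gt a 0 with ha | ha
    · rw [marginalUtility_of_nonpos hγ ha, top_add]
      exact le_top
    have h1 := (hd a z).1.2
    rw [max_eq_left ha.le] at h1
    rw [(hd a z).2]
    exact max_le ((hc.savingMarginal_le hγ.le hB (sub_nonneg.2 h1) z).trans le_add_self)
      le_self_add
  le_mul_share := hd.le_mul_share hγ hc hx

omit [Fintype Z] [DecidableEq Z] in
theorem isAdmissible_wealth (hγ : 0 < γ) (hx : ∀ z, 1 ≤ x z) :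
    IsAdmissible γ B x fun a _ => max a 0 where
  monotone _ _ _ h := max_le_max h le_rfl
  le_add _ a a' h := by
    refine max_le ?_ (add_nonneg (le_max_right _ _) (sub_nonneg.2 h))
    linarith [le_max_left a 0]
  nonneg _ _ := le_max_right _ _
  le_max _ _ := le_rfl
  le_add_bound _ _ :=
    (marginalUtility_antitone hγ.le (le_max_left _ _)).trans le_self_add
  le_mul_share _ z := (marginalUtility_antitone hγ.le (le_max_left _ _)).trans
    (le_mul_of_one_le_left bot_le (hx z))

omit [Fintype Z] [DecidableEq Z] in
-- The map `u'` is antitone and continuous, so it turns infima into suprema and upper bounds on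
-- marginal utility survive. Continuity survives because it is encoded as monotone savings.
theorem isAdmissible_iInf {ι : Type*} [Nonempty ι] (hγ : 0 ≤ γ) {c : ι → ℝ → Z → ℝ}
    (hc : ∀ i, IsAdmissible γ B x (c i)) : IsAdmissible γ B x fun a z => ⨅ i, c i a z := by
  have hbdd : ∀ a z, BddBelow (range fun i => c i a z) := fun a z =>
    ⟨0, by rintro _ ⟨i, rfl⟩; exact (hc i).nonneg a z⟩
  have hmap : ∀ a z, marginalUtility γ (⨅ i, c i a z) = ⨆ i, marginalUtility γ (c i a z) :=
    fun a z => (marginalUtility_antitone hγ).map_ciInf_of_continuousAt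
      (continuous_marginalUtility γ).continuousAt (hbdd a z)
  refine ⟨fun z a a' h => ciInf_mono (hbdd a z) fun i => (hc i).monotone z h,
    fun z a a' h => ?_, fun a z => le_ciInf fun i => (hc i).nonneg a z,
    fun a z => (ciInf_le (hbdd a z) (Classical.arbitrary ι)).trans ((hc _).le_max a z),
    fun a z => ?_, fun a z => ?_⟩
  · rw [← sub_le_iff_le_add]
    refine le_ciInf fun i => ?_
    rw [sub_le_iff_le_add]
    exact (ciInf_le (hbdd a' z) i).trans ((hc i).le_add z a a' h)
  · rw [hmap]
    exact iSup_le fun i => (hc i).le_add_bound a z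
  · rw [hmap]
    exact iSup_le fun i => (hc i).le_mul_share a z

/-- The time iteration operator has an admissible fixed point: the infimum of the admissible
functions which it decreases. -/
theorem exists_isTimeIterate_self (hγ : 0 < γ) (hM : M.Assumptions γ) (hBtop : ∀ z, B z ≠ ⊤)
    (hB : ∀ z, M.discountedMean z (fun z' s => marginalUtility γ (M.Y z z' s)) +
        ∑ z', M.K 1 z z' * B z' ≤ B z)
    (hx : ∀ z, x z = consumptionMap γ (∑ z', M.returnMatrix γ z z' * x z')) :
    ∃ c, IsAdmissible γ B x c ∧ M.IsTimeIterate γ c c := by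
  let I := {c : ℝ → Z → ℝ // IsAdmissible γ B x c ∧
    ∃ d, M.IsTimeIterate γ c d ∧ ∀ a z, d a z ≤ c a z}
  have hw : IsAdmissible γ B x (fun a (_ : Z) => max a 0) :=
    isAdmissible_wealth hγ fun z => (one_le_consumptionMap hγ _).trans (hx z).ge
  obtain ⟨dw, hdw⟩ := hw.exists_timeIterate hγ hM hBtop
  have : Nonempty I := ⟨⟨_, hw, dw, hdw, fun a z => (hdw a z).1.2⟩⟩
  let c : ℝ → Z → ℝ := fun a z => ⨅ i : I, i.1 a z
  have hc : IsAdmissible γ B x c := isAdmissible_iInf hγ.le fun i : I => i.2.1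
  have hc_le : ∀ (i : I) a z, c a z ≤ i.1 a z := fun i a z =>
    ciInf_le ⟨0, by rintro _ ⟨j, rfl⟩; exact j.2.1.nonneg a z⟩ i
  obtain ⟨d, hd⟩ := hc.exists_timeIterate hγ hM hBtop
  have hdc : ∀ a z, d a z ≤ c a z := fun a z => le_ciInf fun i => by
    obtain ⟨d', hd', hle⟩ := i.2.2
    exact (hd.mono hγ hd' i.2.1.monotone (hc_le i) a z).trans (hle a z)
  have hda := hd.isAdmissible hγ hc hB hx
  obtain ⟨e, he⟩ := hda.exists_timeIterate hγ hM hBtop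
  -- The iterate `d` of `c` is itself decreased by the operator, so it takes part in the infimum.
  have hcd : ∀ a z, c a z ≤ d a z :=
    hc_le ⟨d, hda, e, he, he.mono hγ hd hc.monotone hdc⟩
  have : d = c := by
    ext a z
    exact le_antisymm (hdc a z) (hcd a z)
  exact ⟨c, hc, this ▸ hd⟩

end IncomeFluctuation

/-! ### Uniqueness of the consumption function -/

namespace IncomeFluctuation

variable {Z S : Type*} [Fintype Z] [DecidableEq Z] [MeasurableSpace S]
variable {M : IncomeFluctuation Z S} {γ : ℝ} {c d : ℝ → Z → ℝ} {B x : Z → ℝ≥0∞}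

theorem solvesEuler_iff (hγ : 0 < γ) {a ξ : ℝ} {z : Z} :
    M.SolvesEuler γ c a z ξ ↔ ξ ∈ Icc 0 a ∧
      marginalUtility γ ξ = max (M.savingMarginal γ c (a - ξ) z) (marginalUtility γ a) := by
  rw [SolvesEuler, marginalUtility_zero hγ, min_eq_left le_top, expectedMarginal_eq]

theorem IsAdmissible.isConsumptionFunction (hγ : 0 < γ) (hc : IsAdmissible γ B x c)
    (hBtop : ∀ z, B z ≠ ⊤) (h : M.IsTimeIterate γ c c) : M.IsConsumptionFunction γ c := by
  have hle : ∀ a, 0 < a → ∀ z, c a z ≤ a := fun a ha z =>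
    (hc.le_max a z).trans_eq (max_eq_left ha.le)
  refine ⟨⟨fun z => (hc.continuous z).continuousOn, fun z => (hc.monotone z).monotoneOn _,
    fun a _ z => hc.nonneg a z, hle, ?_⟩, fun a ha z =>
    (solvesEuler_iff hγ).2 ⟨⟨hc.nonneg a z, hle a ha z⟩, (h a z).2⟩⟩
  refine ⟨(∑ z, B z).toNNReal, fun a _ z => (hc.le_add_bound a z).trans ?_⟩
  rw [ENNReal.coe_toNNReal (ENNReal.sum_ne_top.2 fun z _ => hBtop z)]
  gcongr
  exact Finset.single_le_sum (fun _ _ => bot_le) (Finset.mem_univ z)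

/-- A bound on the difference of the marginal utilities of two consumption functions improves by
the factor `K(1)`. -/
theorem IsConsumptionFunction.marginalUtility_le_add (hγ : 0 < γ) (hM : M.Assumptions γ)
    (hc : M.IsConsumptionFunction γ c) (hd : M.IsConsumptionFunction γ d) {D : Z → ℝ≥0∞}
    (h : ∀ a, 0 < a → ∀ z, marginalUtility γ (c a z) ≤ marginalUtility γ (d a z) + D z)
    {a : ℝ} (ha : 0 < a) (z : Z) :
    marginalUtility γ (c a z) ≤ marginalUtility γ (d a z) + ∑ z', M.K 1 z z' * D z' := by
  rcases le_or_gt (d a z) (c a z) with hle | hlt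
  · exact (marginalUtility_antitone hγ.le hle).trans le_self_add
  obtain ⟨⟨-, -⟩, h2⟩ := (solvesEuler_iff hγ).1 (hc.2 a ha z)
  obtain ⟨⟨-, h1'⟩, h2'⟩ := (solvesEuler_iff hγ).1 (hd.2 a ha z)
  have hpos : ∀ s, 0 ≤ s → ∀ z', ∀ᵐ t ∂M.μ, 0 < (M.R z z' t : ℝ) * s + M.Y z z' t :=
    fun s hs z' => by
      filter_upwards [hM.ae_income_pos hγ z z'] with t ht
      positivity
  have hs : 0 ≤ a - d a z := sub_nonneg.2 h1'
  rw [h2]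
  refine max_le ?_ (((le_max_right _ _).trans h2'.ge).trans le_self_add)
  -- Here `c` consumes less than `d`, so it saves more; reducing savings to those under `d` only
  -- raises marginal utility.
  calc M.savingMarginal γ c (a - c a z) z
      ≤ M.savingMarginal γ c (a - d a z) z := by
        refine discountedMean_mono fun z' => ?_
        filter_upwards [hpos _ hs z'] with t ht
        have hle : (M.R z z' t : ℝ) * (a - d a z) + M.Y z z' t ≤
            (M.R z z' t : ℝ) * (a - c a z) + M.Y z z' t := by gcongr
        exact marginalUtility_antitone hγ.le (hc.1.monotoneOn z' ht (ht.trans_le hle) hle)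
    _ ≤ M.savingMarginal γ d (a - d a z) z + ∑ z', M.K 1 z z' * D z' := by
        rw [savingMarginal, savingMarginal, ← discountedMean_add_const]
        refine discountedMean_mono fun z' => ?_
        filter_upwards [hpos _ hs z'] with t ht using h _ ht z'
    _ ≤ _ := by
        gcongr
        exact (le_max_left _ _).trans h2'.ge

/-- Iterating the improvement bounds the gap in marginal utility by `D n = K(1) ^ n b` for every
`n`. These bounds have a finite sum, at most `b X`, so the gap vanishes. -/
theorem IsConsumptionFunction.le (hγ : 0 < γ) (hM : M.Assumptions γ)
    (hc : M.IsConsumptionFunction γ c) (hd : M.IsConsumptionFunction γ d)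
    {a : ℝ} (ha : 0 < a) (z : Z) : d a z ≤ c a z := by
  obtain ⟨X, hX, hX'⟩ := exists_supersolution (M.K 1) hM.K_one_finite hM.specRadius_K_one
  obtain ⟨b, hb⟩ := hc.1.bounded
  let D : ℕ → Z → ℝ≥0∞ := fun n => (fun D z => ∑ z', M.K 1 z z' * D z')^[n] fun _ => b
  have hD : ∀ n z, D (n + 1) z = ∑ z', M.K 1 z z' * D n z' := fun n z => by
    simp only [D, Function.iterate_succ_apply']
  have hsum : ∀ n z, ∑ k ∈ Finset.range n, D k z ≤ b * X z := by
    intro n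
    induction n with
    | zero => simp
    | succ n ih =>
      intro z
      rw [Finset.sum_range_succ', ← hX' z, mul_add, mul_one, add_comm]
      refine add_le_add le_rfl ?_
      simp_rw [hD]
      rw [Finset.sum_comm, Finset.mul_sum]
      refine Finset.sum_le_sum fun z' _ => ?_
      rw [← Finset.mul_sum, mul_left_comm]
      exact mul_le_mul_right (ih z') _
  have hle : ∀ n a, 0 < a → ∀ z,
      marginalUtility γ (c a z) ≤ marginalUtility γ (d a z) + D n z := by
    intro n
    induction n with
    | zero =>
      exact fun a ha z => (hb a ha z).trans
        (add_le_add_left (marginalUtility_antitone hγ.le (hd.1.le_wealth a ha z)) _)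
    | succ n ih =>
      intro a ha z
      rw [hD]
      exact hc.marginalUtility_le_add hγ hM hd ih ha z
  set e := marginalUtility γ (c a z) - marginalUtility γ (d a z) with he
  have he0 : e = 0 := by
    by_contra hne
    obtain ⟨n, hn⟩ := ENNReal.exists_nat_mul_gt hne (ENNReal.mul_ne_top ENNReal.coe_ne_top (hX z))
    refine hn.not_ge (le_trans ?_ (hsum n z))
    calc (n : ℝ≥0∞) * e = ∑ _k ∈ Finset.range n, e := by simp
      _ ≤ _ := Finset.sum_le_sum fun k _ => tsub_le_iff_left.2 (hle k a ha z)
  exact le_of_marginalUtility_le hγ (hc.1.nonneg a ha z) (tsub_eq_zero_iff_le.1 he0)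

/-! ### Consumption shares at large wealth -/

/-- The lower limit of the marginal utility of the consumption share bounds the marginal utility of
next-period consumption, when the share `1 - l` of the wealth `a → ∞` is saved. -/
theorem IsAdmissible.mul_le_liminf_discountedMean (hc : IsAdmissible γ B x c) {l : ℝ}
    (hl : l < 1) (z : Z) :
    marginalUtility γ (1 - l) * ∑ z', M.returnMatrix γ z z' *
        liminf (fun a => marginalUtility γ (c a z' / a)) atTop ≤
      liminf (fun a : ℝ => M.discountedMean z fun z' t =>
        marginalUtility γ (c ((M.R z z' t : ℝ) * (a * (1 - l)) + M.Y z z' t) z' / a)) atTop := by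
  rw [← discountedMean_returns]
  refine le_trans (discountedMean_mono_of_return_pos fun z' t ht => ?_)
    (discountedMean_liminf_le z fun a z' => ?_)
  · have hR : (0 : ℝ) < M.R z z' t := ht
    have hl' : 0 < 1 - l := sub_pos.2 hl
    set w : ℝ → ℝ := fun a => (M.R z z' t : ℝ) * (a * (1 - l)) + M.Y z z' t with hw
    have hwtop : Tendsto w atTop atTop :=
      tendsto_atTop_add_const_right _ _
        ((tendsto_id.atTop_mul_const hl').const_mul_atTop hR)
    have hratio : Tendsto (fun a => w a / a) atTop (𝓝 ((M.R z z' t : ℝ) * (1 - l))) := by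
      have h1 : Tendsto (fun a : ℝ => (M.R z z' t : ℝ) * (1 - l) + (M.Y z z' t : ℝ) / a) atTop
          (𝓝 ((M.R z z' t : ℝ) * (1 - l) + 0)) :=
        tendsto_const_nhds.add (tendsto_const_nhds.div_atTop tendsto_id)
      rw [add_zero] at h1
      refine h1.congr' ?_
      filter_upwards [eventually_gt_atTop 0] with a ha
      simp only [hw]
      field_simp
    have hlim := ((continuous_marginalUtility γ).tendsto _).comp hratio
    rw [mul_left_comm, ← marginalUtility_mul hR.le, ← hlim.liminf_eq, mul_comm]
    -- Next-period consumption over `a` factors as `(w / a) (c(w) / w)`, with `w → ∞` and `w / a → R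
    -- (1 - l)`; income has dropped out.
    calc _ ≤ liminf (fun a => marginalUtility γ (w a / a)) atTop *
          liminf (fun a => marginalUtility γ (c (w a) z' / w a)) atTop := by
          refine mul_le_mul_right ?_ _
          exact hwtop.liminf_le_liminf_comp
      _ ≤ _ := ENNReal.le_liminf_mul
      _ ≤ _ := by
          refine liminf_le_liminf ?_
          filter_upwards [hwtop.eventually_gt_atTop 0, eventually_gt_atTop 0] with a hwa ha
          rw [Pi.mul_apply, ← marginalUtility_mul (by positivity)]
          rw [mul_comm, div_mul_div_cancel₀ hwa.ne']
  · refine (continuous_marginalUtility γ).measurable.comp (Measurable.div_const ?_ _)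
    exact (hc.continuous z').measurable.comp
      (((M.measurable_R z z').coe_nnreal_real.mul_const _).add
        (M.measurable_Y z z').coe_nnreal_real)

/-- If `u'(l)` lies below the left side, then at large wealth saving the share `1 - l` has marginal
value above that of consuming `l`. Consuming more than `l` would violate the Euler equation, so the
share is eventually at most `l`. -/
theorem IsAdmissible.consumptionMap_liminf_le (hγ : 0 < γ) (hc : IsAdmissible γ B x c)
    (h : M.IsTimeIterate γ c c) (z : Z) :
    consumptionMap γ (∑ z', M.returnMatrix γ z z' *
        liminf (fun a => marginalUtility γ (c a z' / a)) atTop) ≤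
      liminf (fun a => marginalUtility γ (c a z / a)) atTop := by
  set G := ∑ z', M.returnMatrix γ z z' *
        liminf (fun a => marginalUtility γ (c a z' / a)) atTop with hG
  have hle : ∀ {a}, 0 < a → c a z ≤ a := fun {a} ha =>
    (hc.le_max a z).trans_eq (max_eq_left ha.le)
  refine le_of_forall_lt fun y hy => ?_
  obtain ⟨y', hyy', hy'⟩ := exists_between hy
  refine hyy'.trans_le ?_
  rcases le_or_gt y' 1 with hy1 | hy1
  · refine le_liminf_of_le (by isBoundedDefault) ?_
    filter_upwards [eventually_gt_atTop 0] with a ha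
    rw [← marginalUtility_one (γ := γ)] at hy1
    exact hy1.trans (marginalUtility_antitone hγ.le ((div_le_one ha).2 (hle ha)))
  have hy0 : y' ≠ 0 := (zero_lt_one.trans hy1).ne'
  set l := inverseMarginal γ y'
  have hml : marginalUtility γ l = y' := marginalUtility_inverseMarginal hγ hy0
  have hl0 : 0 < l := by
    refine (inverseMarginal_nonneg γ y').lt_of_ne fun h0 => hy'.ne_top ?_
    rw [← hml, ← marginalUtility_zero hγ]
    exact congrArg _ h0.symm
  have hl1 : l < 1 := by
    by_contra! h1
    have := marginalUtility_antitone hγ.le h1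
    rw [hml, marginalUtility_one] at this
    exact hy1.not_ge this
  rw [← hml] at hy' ⊢
  have hlt := ((marginalUtility_lt_mul_iff hγ hl0 hl1 G).2 hy').trans_le
    (hc.mul_le_liminf_discountedMean hl1 z)
  refine le_liminf_of_le (by isBoundedDefault) ?_
  filter_upwards [eventually_lt_of_lt_liminf hlt, eventually_gt_atTop 0] with a hlta ha
  refine marginalUtility_antitone hγ.le ((div_le_iff₀' ha).2 ?_)
  have hs : marginalUtility γ (a * l) < M.savingMarginal γ c (a * (1 - l)) z := by
    have : M.savingMarginal γ c (a * (1 - l)) z = marginalUtility γ a *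
        M.discountedMean z fun z' t =>
          marginalUtility γ (c ((M.R z z' t : ℝ) * (a * (1 - l)) + M.Y z z' t) z' / a) := by
      rw [← discountedMean_const_mul z (marginalUtility_ne_top ha)]
      simp_rw [← marginalUtility_mul ha.le, mul_div_cancel₀ _ ha.ne']
      rfl
    rw [this, marginalUtility_mul ha.le]
    exact (ENNReal.mul_lt_mul_iff_right (marginalUtility_ne_zero hγ.le a)
      (marginalUtility_ne_top ha)).2 hlta
  by_contra! hcl
  refine hs.not_ge (le_trans ?_ (marginalUtility_antitone hγ.le hcl.le))
  rw [(h a z).2]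
  refine (savingMarginal_antitone hγ.le hc.monotone z ?_).trans (le_max_left _ _)
  linarith

omit [Fintype Z] [DecidableEq Z] in
theorem IsAdmissible.tendsto_share (hγ : 0 < γ) (hc : IsAdmissible γ B x c) (z : Z)
    (hx : x z ≠ 0) (hle : x z ≤ liminf (fun a => marginalUtility γ (c a z / a)) atTop) :
    Tendsto (fun a => c a z / a) atTop (𝓝 (inverseMarginal γ (x z))) := by
  have hev : ∀ᶠ a in atTop, marginalUtility γ (c a z / a) ≤ x z := by
    filter_upwards [eventually_gt_atTop 0] with a ha
    have := hc.le_mul_share a z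
    rw [← mul_div_cancel₀ (c a z) ha.ne', marginalUtility_mul ha.le, mul_comm (x z)] at this
    exact (ENNReal.mul_le_mul_iff_right (marginalUtility_ne_zero hγ.le a)
      (marginalUtility_ne_top ha)).1 this
  have hlim : Tendsto (fun a => marginalUtility γ (c a z / a)) atTop (𝓝 (x z)) :=
    tendsto_of_le_liminf_of_limsup_le hle (limsup_le_of_le (by isBoundedDefault) hev)
  refine ((inverseMarginal_continuousAt hγ hx).tendsto.comp hlim).congr' ?_
  filter_upwards [eventually_gt_atTop 0] with a ha
  exact inverseMarginal_marginalUtility hγ (div_nonneg (hc.nonneg a z) ha.le)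

/-- The operator whose least fixed point consists of the marginal utilities of the asymptotic
marginal propensities to consume, for a matrix `L` of values of savings. -/
noncomputable def shareOperator (hγ : 0 < γ) (L : Z → Z → ℝ≥0∞) : (Z → ℝ≥0∞) →o (Z → ℝ≥0∞) where
  toFun x := fun z => consumptionMap γ (∑ z', L z z' * x z')
  monotone' _ _ h _ := (consumptionMap_strictMono hγ).monotone
    (Finset.sum_le_sum fun z' _ => mul_le_mul_right (h z') _)

theorem Assumptions.hasAsymptoticMPC (hγ : 0 < γ) (hM : M.Assumptions γ) :
    M.HasAsymptoticMPC γ fun z =>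
      inverseMarginal γ ((shareOperator hγ (M.returnMatrix γ)).lfp z) := by
  obtain ⟨B, hBtop, hB⟩ := hM.exists_bound
  set x := (shareOperator hγ (M.returnMatrix γ)).lfp
  have hx : ∀ z, x z = consumptionMap γ (∑ z', M.returnMatrix γ z z' * x z') := fun z =>
    (congrFun (shareOperator hγ (M.returnMatrix γ)).map_lfp z).symm
  obtain ⟨c, hc, hcc⟩ := exists_isTimeIterate_self hγ hM hBtop hB hx
  have hcons := hc.isConsumptionFunction hγ hBtop hcc
  refine ⟨c, hcons, fun d hd a ha z => le_antisymm (hcons.le hγ hM hd ha z)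
    (hd.le hγ hM hcons ha z), fun z => hc.tendsto_share hγ z ?_ ?_⟩
  · exact (zero_lt_one.trans_le ((one_le_consumptionMap hγ _).trans (hx z).ge)).ne'
  -- Leastness is essential here: the lower limits are only known to be a pre-fixed point.
  · exact (shareOperator hγ (M.returnMatrix γ)).lfp_le
      (a := fun z => liminf (fun a => marginalUtility γ (c a z / a)) atTop)
      (fun z => hc.consumptionMap_liminf_le hγ hcc z) z

end IncomeFluctuation

theorem corollary1 {Z S S' : Type*} [Fintype Z] [DecidableEq Z]
    [MeasurableSpace S] [MeasurableSpace S'] (γ : ℝ) (hγ : 0 < γ)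
    (M : IncomeFluctuation Z S) (M' : IncomeFluctuation Z S')
    (hM : M.Assumptions γ) (hM' : M'.Assumptions γ)
    (hP : M.P = M'.P)
    (hβR : ∀ z z', IdentDistrib (fun s => (M.β z z' s, M.R z z' s))
      (fun s => (M'.β z z' s, M'.R z z' s)) M.μ M'.μ) :
    ∃ cbar : Z → ℝ, (∀ z, cbar z ∈ Icc (0 : ℝ) 1) ∧
      M.HasAsymptoticMPC γ cbar ∧ M'.HasAsymptoticMPC γ cbar := by
  -- The limits are a function of `γ` and this matrix, which depends only on `γ`, `P` and the joint
  -- laws of `(β, R)`.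
  have hL : M.returnMatrix γ = M'.returnMatrix γ := by
    ext z z'
    have hm : Measurable fun p : ℝ≥0 × ℝ≥0 =>
        (p.1 : ℝ≥0∞) * (p.2 : ℝ≥0∞) * marginalUtility γ p.2 :=
      (measurable_fst.coe_nnreal_ennreal.mul measurable_snd.coe_nnreal_ennreal).mul
        ((continuous_marginalUtility γ).measurable.comp measurable_snd.coe_nnreal_real)
    rw [IncomeFluctuation.returnMatrix, IncomeFluctuation.returnMatrix, hP]
    exact congrArg _ ((hβR z z').comp hm).lintegral_eq
  refine ⟨_, fun z => ⟨inverseMarginal_nonneg _ _, ?_⟩, hM.hasAsymptoticMPC hγ, ?_⟩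
  · refine inverseMarginal_le hγ zero_le_one ?_
    rw [marginalUtility_one,
      ← (IncomeFluctuation.shareOperator hγ (M.returnMatrix γ)).map_lfp]
    exact one_le_consumptionMap hγ _
  · rw [hL]
    exact hM'.hasAsymptoticMPC hγ
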